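/- Let $K$ be an imaginary quadratic field with a fixed embedding $K\subset\mathbb{C}$, let $\mathfrak m\subset\mathcal O_K$ be a nonzero ideal and let $k\ge 1$ be an integer. Let $I_{\mathfrak m}$ be the group of fractional ideals of $K$ coprime to $\mathfrak m$, and let $\varrho\colon I_{\mathfrak m}\to\mathbb{C}^\times$ be an algebraic Hecke character of weight $k$, i.e. a homomorphism such that $$\varrho(\alpha\mathcal O_K)=\alpha^{k-1}\quad\text{for all }\alpha\in K^\times\text{ with }\alpha\mathcal O_K\in I_{\mathfrak m}\text{ and }\alpha\equiv 1 \bmod \mathfrak m$$ ($\mathfrak m$ is not required to be the largest such ideal). Let $\mathbb{Q}(\varrho)\subset\mathbb{C}$ be the field generated over $\mathbb{Q}$ by the values of $\varrho$. Let $$\vartheta_\varrho=\sum_{\mathfrak a}\varrho(\mathfrak a)\,q^{\mathrm{Nm}(\mathfrak a)},$$ where the sum runs over the nonzero integral ideals $\mathfrak a$ of $\mathcal O_K$ and $\varrho(\mathfrak a)=0$ if $\mathfrak a$ is not coprime to $\mathfrak m$, and let $F_\varrho\subset\mathbb{Q}(\varrho)$ be the field generated over $\mathbb{Q}$ by the Fourier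 coefficients of $\vartheta_\varrho$, i.e. the coefficients of this $q$-series. Then: 1. The extension $\mathbb{Q}(\varrho)/F_\varrho$ is a finite Galois extension, and its Galois group is an elementary abelian $2$-group, i.e. it is abelian and each of its elements has order dividing $2$ (it may be trivial). 2. The field $\mathbb{Q}(\varrho)$ is a number field and is Kroneckerian, i.e. it is totally real or a CM field. -/

import Mathlib

open NumberField
open scoped nonZeroDivisors

noncomputable section

namespace CMTheta

variable {K : Type*} [Field K] [NumberField K]

/-- The group `I_𝔪` of fractional ideals of `K` that are coprime to the modulus `𝔪`: no prime
dividing `𝔪` occurs in the factorization. -/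
def coprimeIdeals (𝔪 : Ideal (𝓞 K)) : Subgroup (FractionalIdeal (𝓞 K)⁰ K)ˣ where
  carrier := {I | ∀ v : IsDedekindDomain.HeightOneSpectrum (𝓞 K), v.asIdeal ∣ 𝔪 →
    FractionalIdeal.count K v (I : FractionalIdeal (𝓞 K)⁰ K) = 0}
  one_mem' := fun v _ => by
    rw [Units.val_one, FractionalIdeal.count_one]
  mul_mem' := fun {I J} hI hJ v hv => by
    rw [Units.val_mul, FractionalIdeal.count_mul K v I.ne_zero J.ne_zero, hI v hv, hJ v hv,
      add_zero]
  inv_mem' := fun {I} hI v hv => by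
    rw [Units.val_inv_eq_inv_val, FractionalIdeal.count_inv, hI v hv, neg_zero]

/-- The congruence `α ≡ 1 mod 𝔪` for a nonzero element `α` of `K`, not necessarily integral:
`α = a / b` with `a, b` integral, `b` coprime to `𝔪` and `a ≡ b mod 𝔪`. -/
def CongrOne (𝔪 : Ideal (𝓞 K)) (α : Kˣ) : Prop :=
  ∃ a b : 𝓞 K, IsCoprime (Ideal.span {b}) 𝔪 ∧ a - b ∈ 𝔪 ∧ (α : K) * (b : K) = (a : K)

/-- Algebraic Hecke characters of weight `k` on the fractional ideals of `K` coprime to `𝔪`, where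
`K` is embedded in `ℂ` by `ι`: characters `ϱ` of `I_𝔪` with `ϱ(α 𝓞) = α ^ (k - 1)` for all
principal ideals `α 𝓞` in `I_𝔪` with `α ≡ 1 mod 𝔪`. -/
structure AlgebraicHeckeCharacter (ι : K →+* ℂ) (𝔪 : Ideal (𝓞 K)) (k : ℕ) where
  /-- the underlying character -/
  toHom : coprimeIdeals 𝔪 →* ℂˣ
  map_principal : ∀ (α : Kˣ) (h : toPrincipalIdeal (𝓞 K) K α ∈ coprimeIdeals 𝔪),
    CongrOne 𝔪 α → (toHom ⟨toPrincipalIdeal (𝓞 K) K α, h⟩ : ℂ) = ι (α : K) ^ (k - 1)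

namespace AlgebraicHeckeCharacter

variable {ι : K →+* ℂ} {𝔪 : Ideal (𝓞 K)} {k : ℕ} (ϱ : AlgebraicHeckeCharacter ι 𝔪 k)

/-- The field `ℚ(ϱ) ⊆ ℂ` generated by the values of `ϱ`. -/
def valueField : IntermediateField ℚ ℂ :=
  IntermediateField.adjoin ℚ (Set.range fun I : coprimeIdeals 𝔪 => (ϱ.toHom I : ℂ))

open Classical in
/-- The value `ϱ(𝔞)` at an integral ideal `𝔞`, with the usual convention that it is `0` if `𝔞` is
zero or not coprime to `𝔪`. -/
def onIdeal (𝔞 : Ideal (𝓞 K)) : ℂ :=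
  if h : ∃ h₀ : 𝔞 ∈ (Ideal (𝓞 K))⁰, FractionalIdeal.mk0 K ⟨𝔞, h₀⟩ ∈ coprimeIdeals 𝔪 then
    (ϱ.toHom ⟨FractionalIdeal.mk0 K ⟨𝔞, h.1⟩, h.2⟩ : ℂ)
  else 0

/-- The theta series `ϑ_ϱ = ∑ ϱ(𝔞) q ^ Nm(𝔞)`, the sum over the integral ideals `𝔞`, as a
`q`-series: its `n`-th Fourier coefficient is the sum of `ϱ(𝔞)` over the finitely many `𝔞` of
norm `n`. -/
def theta : PowerSeries ℂ :=
  PowerSeries.mk fun n =>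
    ∑ 𝔞 ∈ (Ideal.finite_setOfPred_absNorm_eq (S := 𝓞 K) n).toFinset, ϱ.onIdeal 𝔞

/-- The field `F_ϱ ⊆ ℂ` generated by the Fourier coefficients of `ϑ_ϱ`. -/
def coeffField : IntermediateField ℚ ℂ :=
  IntermediateField.adjoin ℚ (Set.range fun n : ℕ => PowerSeries.coeff n ϱ.theta)

theorem onIdeal_mem_valueField (𝔞 : Ideal (𝓞 K)) : ϱ.onIdeal 𝔞 ∈ ϱ.valueField := by
  unfold onIdeal
  split_ifs with h
  · exact IntermediateField.subset_adjoin ℚ _ ⟨_, rfl⟩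
  · exact zero_mem _

theorem coeffField_le_valueField : ϱ.coeffField ≤ ϱ.valueField := by
  refine IntermediateField.adjoin_le_iff.mpr ?_
  rintro _ ⟨n, rfl⟩
  simp only [theta, PowerSeries.coeff_mk]
  exact sum_mem fun 𝔞 _ => ϱ.onIdeal_mem_valueField 𝔞

/-- `ℚ(ϱ)` as an extension of `F_ϱ`. -/
abbrev valueFieldOver : IntermediateField ϱ.coeffField ℂ :=
  IntermediateField.extendScalars ϱ.coeffField_le_valueField

end AlgebraicHeckeCharacter

/-- An elementary abelian `2`-group: abelian, and every element has order dividing `2`. -/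
def IsElementaryAbelianTwoGroup (G : Type*) [Group G] : Prop :=
  (∀ g h : G, g * h = h * g) ∧ ∀ g : G, g ^ 2 = 1

/-- A number field is Kroneckerian if it is totally real or a CM field. -/
def IsKroneckerian (L : Type*) [Field L] [CharZero L] : Prop :=
  NumberField L ∧ (IsTotallyReal L ∨ IsCMField L)

end CMTheta

end

/-! ### Values of the character on integral ideals -/

namespace CMTheta

variable {K : Type*} [Field K] [NumberField K] {ι : K →+* ℂ} {𝔪 : Ideal (𝓞 K)} {k : ℕ}

/-! Extended by zero, `ϱ` is multiplicative on integral ideals, so its values at primes generate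
ℚ(ϱ).

Galois part: let `P * Q = (p)` with `P ≠ Q` of norm `p`, and let x, y be the values at `P`, `Q`. The
coefficients of the theta series at p and p² are x + y and x² + xy + y², so F contains x + y and xy.
For the other primes the value at `P` is itself a coefficient. Hence ℚ(ϱ) is generated over F by
roots of quadratics that split in it. An automorphism fixes or swaps the two roots of each, so it is
an involution (`isGalois_of_adjoin_eq_of_quadratic`, `exists_add_mem_mul_mem_coeffField`).

Kroneckerian part: up to factors from `ι K`, `ϱ` takes finitely many values on integral ideals, and
a power of each nonzero value lies in `ι K`, so ℚ(ϱ) is a number field. Comparing absolute values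
gives |φ(ϱ(A))|² = N(A)^(k-1) for every embedding φ and every nonzero A coprime to `𝔪`. So complex
conjugation acts as ϱ(A) ↦ N(A)^(k-1)/ϱ(A), independently of φ, and a field with such a conjugation
is totally real or CM (`norm_sq_map_onIdeal`, `isKroneckerian_of_forall_conj`). -/

theorem count_coeIdeal_eq_zero_iff (v : IsDedekindDomain.HeightOneSpectrum (𝓞 K))
    {A : Ideal (𝓞 K)} (hA : A ≠ 0) :
    FractionalIdeal.count K v (A : FractionalIdeal (𝓞 K)⁰ K) = 0 ↔ ¬ v.asIdeal ∣ A := by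
  classical
  rw [FractionalIdeal.count_coe K v hA, Nat.cast_eq_zero, ← not_iff_not, not_not]
  exact Associates.count_ne_zero_iff_dvd hA v.irreducible

theorem isCoprime_of_forall_not_dvd {A : Ideal (𝓞 K)} (hA : A ≠ 0)
    (h : ∀ v : IsDedekindDomain.HeightOneSpectrum (𝓞 K), v.asIdeal ∣ 𝔪 → ¬ v.asIdeal ∣ A) :
    IsCoprime A 𝔪 := by
  rw [Ideal.isCoprime_iff_sup_eq]
  by_contra hne
  obtain ⟨M, hM, hle⟩ := Ideal.exists_le_maximal _ hne
  have hAM : A ≤ M := le_sup_left.trans hle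
  have hM0 : M ≠ ⊥ := by
    rintro rfl
    exact hA (le_bot_iff.mp hAM)
  exact h ⟨M, hM.isPrime, hM0⟩ (Ideal.dvd_iff_le.mpr (le_sup_right.trans hle))
    (Ideal.dvd_iff_le.mpr hAM)

theorem mk0_mem_coprimeIdeals_iff (A : (Ideal (𝓞 K))⁰) :
    FractionalIdeal.mk0 K A ∈ coprimeIdeals 𝔪 ↔ IsCoprime (A : Ideal (𝓞 K)) 𝔪 := by
  have hA : (A : Ideal (𝓞 K)) ≠ 0 := nonZeroDivisors.ne_zero A.2
  have : FractionalIdeal.mk0 K A ∈ coprimeIdeals 𝔪 ↔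
      ∀ v : IsDedekindDomain.HeightOneSpectrum (𝓞 K), v.asIdeal ∣ 𝔪 →
        ¬ v.asIdeal ∣ (A : Ideal (𝓞 K)) :=
    forall₂_congr fun v _ => count_coeIdeal_eq_zero_iff v hA
  rw [this]
  refine ⟨isCoprime_of_forall_not_dvd hA, fun h v hv hvA => ?_⟩
  exact v.prime.not_isUnit (h.isUnit_of_dvd' hvA hv)

namespace AlgebraicHeckeCharacter

variable (ϱ : AlgebraicHeckeCharacter ι 𝔪 k)

theorem onIdeal_eq_toHom {A : Ideal (𝓞 K)} (J : coprimeIdeals 𝔪)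
    (h : ((J : (FractionalIdeal (𝓞 K)⁰ K)ˣ) : FractionalIdeal (𝓞 K)⁰ K) = A) :
    ϱ.onIdeal A = ϱ.toHom J := by
  have hA : A ∈ (Ideal (𝓞 K))⁰ := by
    refine mem_nonZeroDivisors_of_ne_zero fun h0 => ?_
    refine (J : (FractionalIdeal (𝓞 K)⁰ K)ˣ).ne_zero ?_
    rw [h, h0]
    exact FractionalIdeal.coeIdeal_bot
  have hJ : FractionalIdeal.mk0 K ⟨A, hA⟩ = J := Units.ext h.symm
  have hm : FractionalIdeal.mk0 K ⟨A, hA⟩ ∈ coprimeIdeals 𝔪 := hJ ▸ J.2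
  have hJ' : (⟨FractionalIdeal.mk0 K ⟨A, hA⟩, hm⟩ : coprimeIdeals 𝔪) = J := Subtype.ext hJ
  rw [← hJ']
  exact dif_pos ⟨hA, hm⟩

theorem _root_.CMTheta.exists_coprimeIdeals_coe_eq {A : Ideal (𝓞 K)} (hA : A ≠ 0)
    (hc : IsCoprime A 𝔪) : ∃ J : coprimeIdeals 𝔪,
      ((J : (FractionalIdeal (𝓞 K)⁰ K)ˣ) : FractionalIdeal (𝓞 K)⁰ K) = A :=
  ⟨⟨FractionalIdeal.mk0 K ⟨A, mem_nonZeroDivisors_of_ne_zero hA⟩,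
    (mk0_mem_coprimeIdeals_iff _).mpr hc⟩, rfl⟩

theorem onIdeal_ne_zero {A : Ideal (𝓞 K)} (hA : A ≠ 0) (hc : IsCoprime A 𝔪) :
    ϱ.onIdeal A ≠ 0 := by
  obtain ⟨J, hJ⟩ := exists_coprimeIdeals_coe_eq hA hc
  rw [ϱ.onIdeal_eq_toHom J hJ]
  exact Units.ne_zero _

theorem onIdeal_zero : ϱ.onIdeal 0 = 0 :=
  dif_neg fun h => nonZeroDivisors.ne_zero h.1 rfl

theorem onIdeal_of_not_isCoprime {A : Ideal (𝓞 K)} (hc : ¬ IsCoprime A 𝔪) :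
    ϱ.onIdeal A = 0 :=
  dif_neg fun h => hc ((mk0_mem_coprimeIdeals_iff ⟨A, h.1⟩).mp h.2)

theorem onIdeal_one : ϱ.onIdeal 1 = 1 := by
  rw [Ideal.one_eq_top, ϱ.onIdeal_eq_toHom 1 (FractionalIdeal.coeIdeal_top _).symm, map_one,
    Units.val_one]

theorem onIdeal_mul (A B : Ideal (𝓞 K)) : ϱ.onIdeal (A * B) = ϱ.onIdeal A * ϱ.onIdeal B := by
  by_cases hA : A = 0
  · rw [hA, zero_mul, onIdeal_zero, zero_mul]
  by_cases hB : B = 0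
  · rw [hB, mul_zero, onIdeal_zero, mul_zero]
  by_cases hcA : IsCoprime A 𝔪
  · by_cases hcB : IsCoprime B 𝔪
    · obtain ⟨I, hI⟩ := exists_coprimeIdeals_coe_eq hA hcA
      obtain ⟨J, hJ⟩ := exists_coprimeIdeals_coe_eq hB hcB
      rw [ϱ.onIdeal_eq_toHom I hI, ϱ.onIdeal_eq_toHom J hJ, ϱ.onIdeal_eq_toHom (I * J),
        map_mul, Units.val_mul]
      rw [FractionalIdeal.coeIdeal_mul, ← hI, ← hJ, Subgroup.coe_mul, Units.val_mul]
    · rw [ϱ.onIdeal_of_not_isCoprime hcB, mul_zero]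
      exact ϱ.onIdeal_of_not_isCoprime fun h => hcB (IsCoprime.of_mul_left_right h)
  · rw [ϱ.onIdeal_of_not_isCoprime hcA, zero_mul]
    exact ϱ.onIdeal_of_not_isCoprime fun h => hcA (IsCoprime.of_mul_left_left h)

theorem onIdeal_pow (A : Ideal (𝓞 K)) (n : ℕ) : ϱ.onIdeal (A ^ n) = ϱ.onIdeal A ^ n := by
  induction n with
  | zero => rw [pow_zero, pow_zero, onIdeal_one]
  | succ n ih => rw [pow_succ, pow_succ, onIdeal_mul, ih]

theorem onIdeal_mem_of_prime (T : Subfield ℂ)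
    (hT : ∀ P : Ideal (𝓞 K), Prime P → ϱ.onIdeal P ∈ T) (A : Ideal (𝓞 K)) :
    ϱ.onIdeal A ∈ T := by
  induction A using UniqueFactorizationMonoid.induction_on_prime with
  | h₁ => rw [onIdeal_zero]; exact T.zero_mem
  | h₂ A hA =>
    rw [Ideal.isUnit_iff.mp hA, ← Ideal.one_eq_top, onIdeal_one]; exact T.one_mem
  | h₃ A P _ hP ih => rw [onIdeal_mul]; exact T.mul_mem (hT P hP) ih

/-- Split the prime factorization by the sign of the exponents. Primes dividing `𝔪` have exponent 0,
so numerator and denominator stay coprime to `𝔪`. -/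
theorem exists_mul_coeIdeal_eq (I : coprimeIdeals 𝔪) :
    ∃ A B : Ideal (𝓞 K), A ≠ 0 ∧ B ≠ 0 ∧ IsCoprime A 𝔪 ∧ IsCoprime B 𝔪 ∧
      ((I : (FractionalIdeal (𝓞 K)⁰ K)ˣ) : FractionalIdeal (𝓞 K)⁰ K) * B = A := by
  rw [← FractionalIdeal.finprod_heightOneSpectrum_factorization' K
    (I : (FractionalIdeal (𝓞 K)⁰ K)ˣ).ne_zero]
  refine finprod_induction (p := fun J : FractionalIdeal (𝓞 K)⁰ K =>
    ∃ A B : Ideal (𝓞 K), A ≠ 0 ∧ B ≠ 0 ∧ IsCoprime A 𝔪 ∧ IsCoprime B 𝔪 ∧ J * B = A) ?_ ?_ ?_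
  · exact ⟨1, 1, one_ne_zero, one_ne_zero, isCoprime_one_left, isCoprime_one_left, by simp⟩
  · rintro J J' ⟨A, B, hA, hB, hcA, hcB, h⟩ ⟨A', B', hA', hB', hcA', hcB', h'⟩
    refine ⟨A * A', B * B', mul_ne_zero hA hA', mul_ne_zero hB hB', hcA.mul_left hcA',
      hcB.mul_left hcB', ?_⟩
    rw [FractionalIdeal.coeIdeal_mul, FractionalIdeal.coeIdeal_mul, ← h, ← h']
    ring
  · intro v
    by_cases hv : v.asIdeal ∣ 𝔪
    · rw [I.2 v hv]
      exact ⟨1, 1, one_ne_zero, one_ne_zero, isCoprime_one_left, isCoprime_one_left, by simp⟩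
    have hv0 : v.asIdeal ≠ 0 := v.ne_bot
    have hc : IsCoprime v.asIdeal 𝔪 := by
      refine isCoprime_of_forall_not_dvd hv0 fun w hw hwv => hv ?_
      rwa [associated_iff_eq.mp ((w.prime.dvd_prime_iff_associated v.prime).mp hwv)] at hw
    rcases Int.eq_nat_or_neg (FractionalIdeal.count K v
      ((I : (FractionalIdeal (𝓞 K)⁰ K)ˣ) : FractionalIdeal (𝓞 K)⁰ K)) with ⟨n, hn | hn⟩
    · refine ⟨v.asIdeal ^ n, 1, pow_ne_zero _ hv0, one_ne_zero, hc.pow_left,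
        isCoprime_one_left, ?_⟩
      rw [hn, zpow_natCast, FractionalIdeal.coeIdeal_pow]
      rw [Ideal.one_eq_top, FractionalIdeal.coeIdeal_top, mul_one]
    · refine ⟨1, v.asIdeal ^ n, one_ne_zero, pow_ne_zero _ hv0, isCoprime_one_left,
        hc.pow_left, ?_⟩
      have : (v.asIdeal : FractionalIdeal (𝓞 K)⁰ K) ^ n ≠ 0 :=
        pow_ne_zero _ (FractionalIdeal.coeIdeal_ne_zero.mpr hv0)
      rw [hn, zpow_neg, zpow_natCast, FractionalIdeal.coeIdeal_pow, inv_mul_cancel₀ this]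
      rw [Ideal.one_eq_top, FractionalIdeal.coeIdeal_top]

theorem toHom_mem (T : Subfield ℂ) (hT : ∀ A : Ideal (𝓞 K), ϱ.onIdeal A ∈ T)
    (I : coprimeIdeals 𝔪) : (ϱ.toHom I : ℂ) ∈ T := by
  obtain ⟨A, B, hA, hB, hcA, hcB, h⟩ := exists_mul_coeIdeal_eq I
  obtain ⟨I', hI'⟩ := exists_coprimeIdeals_coe_eq hB hcB
  have hmul : (ϱ.toHom I : ℂ) * ϱ.onIdeal B = ϱ.onIdeal A := by
    rw [ϱ.onIdeal_eq_toHom I' hI', ϱ.onIdeal_eq_toHom (I * I'), map_mul, Units.val_mul]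
    rw [Subgroup.coe_mul, Units.val_mul, hI', h]
  rw [eq_div_of_mul_eq (ϱ.onIdeal_ne_zero hB hcB) hmul]
  exact T.div_mem (hT A) (hT B)

theorem valueField_eq_adjoin_onIdeal :
    ϱ.valueField = IntermediateField.adjoin ℚ (Set.range ϱ.onIdeal) := by
  apply le_antisymm
  · refine IntermediateField.adjoin_le_iff.mpr ?_
    rintro _ ⟨I, rfl⟩
    exact ϱ.toHom_mem (IntermediateField.adjoin ℚ (Set.range ϱ.onIdeal)).toSubfield
      (fun A => IntermediateField.subset_adjoin ℚ _ ⟨A, rfl⟩) I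
  · refine IntermediateField.adjoin_le_iff.mpr ?_
    rintro _ ⟨A, rfl⟩
    exact ϱ.onIdeal_mem_valueField A

theorem valueField_le_of_prime (T : IntermediateField ℚ ℂ)
    (hT : ∀ P : Ideal (𝓞 K), Prime P → ϱ.onIdeal P ∈ T) : ϱ.valueField ≤ T := by
  rw [valueField_eq_adjoin_onIdeal, IntermediateField.adjoin_le_iff]
  rintro _ ⟨A, rfl⟩
  exact ϱ.onIdeal_mem_of_prime T.toSubfield hT A

end AlgebraicHeckeCharacter

end CMTheta

/-! ### Finiteness modulo principal ideals and algebraicity -/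

namespace CMTheta

variable {K : Type*} [Field K] [NumberField K] {ι : K →+* ℂ} {𝔪 : Ideal (𝓞 K)} {k : ℕ}

/-- A substitute for finiteness of the ray class group. For each ideal class fix `D`, coprime to
`𝔪`, in the inverse class, and send `A` to its class and the residue mod `𝔪` of a generator of `A *
D`. Equal images give generators a ≡ b, and `D` cancels. -/
theorem exists_map_finite_of_isCoprime (𝔪 : Ideal (𝓞 K)) :
    ∃ f : {A : Ideal (𝓞 K) // A ≠ 0 ∧ IsCoprime A 𝔪} → ClassGroup (𝓞 K) × (𝓞 K ⧸ 𝔪),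
      ∀ A B, f A = f B → ∃ a b : 𝓞 K, a ≠ 0 ∧ b ≠ 0 ∧ IsCoprime (Ideal.span {b}) 𝔪 ∧
        a - b ∈ 𝔪 ∧ Ideal.span {b} * (A : Ideal (𝓞 K)) = Ideal.span {a} * B := by
  classical
  let cl : {A : Ideal (𝓞 K) // A ≠ 0 ∧ IsCoprime A 𝔪} → ClassGroup (𝓞 K) :=
    fun A => ClassGroup.mk0 ⟨A, mem_nonZeroDivisors_of_ne_zero A.2.1⟩
  have hD : ∀ c : ClassGroup (𝓞 K), ∃ D : Ideal (𝓞 K), D ≠ 0 ∧ IsCoprime D 𝔪 ∧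
      ∀ A, cl A = c → ∃ a : 𝓞 K, (A : Ideal (𝓞 K)) * D = Ideal.span {a} := by
    intro c
    by_cases hc : ∃ A, cl A = c
    · obtain ⟨A₀, rfl⟩ := hc
      -- With h the class number, the power h - 1 inverts the class while keeping coprimality to
      -- `𝔪`.
      refine ⟨(A₀ : Ideal (𝓞 K)) ^ (Fintype.card (ClassGroup (𝓞 K)) - 1),
        pow_ne_zero _ A₀.2.1, A₀.2.2.pow_left, fun A hA => ?_⟩
      have h1 : ClassGroup.mk0 (⟨A, mem_nonZeroDivisors_of_ne_zero A.2.1⟩ *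
          ⟨(A₀ : Ideal (𝓞 K)), mem_nonZeroDivisors_of_ne_zero A₀.2.1⟩ ^
            (Fintype.card (ClassGroup (𝓞 K)) - 1)) = 1 := by
        rw [map_mul, map_pow]
        change cl A * cl A₀ ^ _ = 1
        rw [hA, mul_pow_sub_one Fintype.card_ne_zero, pow_card_eq_one]
      rw [ClassGroup.mk0_eq_one_iff] at h1
      obtain ⟨a, ha⟩ := h1
      exact ⟨a, ha⟩
    · exact ⟨1, one_ne_zero, isCoprime_one_left, fun A hA => (hc ⟨A, hA⟩).elim⟩
  choose D hD0 hDc hDa using hD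
  choose α hα using fun A => hDa (cl A) A rfl
  refine ⟨fun A => (cl A, Ideal.Quotient.mk 𝔪 (α A)), fun A B hAB => ?_⟩
  obtain ⟨h1, h2⟩ := Prod.mk.inj hAB
  have hne : ∀ A, α A ≠ 0 := by
    intro A h0
    refine mul_ne_zero A.2.1 (hD0 (cl A)) ((hα A).trans ?_)
    rw [h0]
    exact Ideal.span_singleton_eq_bot.mpr rfl
  refine ⟨α A, α B, hne A, hne B, ?_, Ideal.Quotient.eq.mp h2, ?_⟩
  · rw [← hα B]
    exact B.2.2.mul_left (hDc _)
  · rw [← hα A, ← hα B, h1]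
    ring

namespace AlgebraicHeckeCharacter

variable (ϱ : AlgebraicHeckeCharacter ι 𝔪 k)

/-- The fractional ideal A/B is generated by a/b ≡ 1 mod `𝔪`, where `ϱ` is prescribed. -/
theorem onIdeal_mul_pow_eq {A B : Ideal (𝓞 K)} (hA : A ≠ 0) (hB : B ≠ 0)
    (hcA : IsCoprime A 𝔪) (hcB : IsCoprime B 𝔪) {a b : 𝓞 K} (ha : a ≠ 0) (hb : b ≠ 0)
    (hcb : IsCoprime (Ideal.span {b}) 𝔪) (hab : a - b ∈ 𝔪)
    (h : Ideal.span {b} * A = Ideal.span {a} * B) :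
    ϱ.onIdeal A * ι b ^ (k - 1) = ι a ^ (k - 1) * ϱ.onIdeal B := by
  have ha' : (a : K) ≠ 0 := RingOfIntegers.coe_ne_zero_iff.mpr ha
  have hb' : (b : K) ≠ 0 := RingOfIntegers.coe_ne_zero_iff.mpr hb
  obtain ⟨I, hI⟩ := exists_coprimeIdeals_coe_eq hA hcA
  obtain ⟨J, hJ⟩ := exists_coprimeIdeals_coe_eq hB hcB
  set u : Kˣ := Units.mk0 ((a : K) / b) (div_ne_zero ha' hb') with hu
  have h1 : toPrincipalIdeal (𝓞 K) K u = I * (J : (FractionalIdeal (𝓞 K)⁰ K)ˣ)⁻¹ := by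
    rw [eq_mul_inv_iff_mul_eq]
    ext1
    rw [Units.val_mul, coe_toPrincipalIdeal, hI, hJ, hu, Units.val_mk0]
    have hb'' : FractionalIdeal.spanSingleton (𝓞 K)⁰ (b : K) ≠ 0 :=
      FractionalIdeal.spanSingleton_ne_zero_iff.mpr hb'
    apply mul_left_cancel₀ hb''
    rw [← mul_assoc, FractionalIdeal.spanSingleton_mul_spanSingleton, mul_div_cancel₀ _ hb']
    have h2 := congrArg (fun X : Ideal (𝓞 K) => (X : FractionalIdeal (𝓞 K)⁰ K)) h
    simp only [FractionalIdeal.coeIdeal_mul, FractionalIdeal.coeIdeal_span_singleton] at h2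
    exact h2.symm
  have hmem : toPrincipalIdeal (𝓞 K) K u ∈ coprimeIdeals 𝔪 := by
    rw [h1]
    exact mul_mem I.2 (inv_mem J.2)
  have h2 := ϱ.map_principal u hmem ⟨a, b, hcb, hab, div_mul_cancel₀ _ hb'⟩
  have h3 : (⟨toPrincipalIdeal (𝓞 K) K u, hmem⟩ : coprimeIdeals 𝔪) = I * J⁻¹ := Subtype.ext h1
  rw [h3, map_mul, map_inv, Units.val_mul, Units.val_inv_eq_inv_val, hu, Units.val_mk0, map_div₀,
    ← ϱ.onIdeal_eq_toHom I hI, ← ϱ.onIdeal_eq_toHom J hJ, div_pow] at h2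
  have h4 : ι b ^ (k - 1) ≠ 0 := pow_ne_zero _ ((map_ne_zero ι).mpr hb')
  have h5 := ϱ.onIdeal_ne_zero hB hcB
  field_simp at h2
  rw [h2, mul_comm]

/-- Pigeonhole on the powers of `A`. The norm identity is kept for computing absolute values later.
-/
theorem exists_onIdeal_pow_mul_eq (h𝔪 : 𝔪 ≠ ⊥) {A : Ideal (𝓞 K)} (hA : A ≠ 0)
    (hcA : IsCoprime A 𝔪) :
    ∃ (n : ℕ) (a b : 𝓞 K), n ≠ 0 ∧ a ≠ 0 ∧ b ≠ 0 ∧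
      Ideal.absNorm A ^ n * Ideal.absNorm (Ideal.span {b}) = Ideal.absNorm (Ideal.span {a}) ∧
      ϱ.onIdeal A ^ n * ι b ^ (k - 1) = ι a ^ (k - 1) := by
  obtain ⟨f, hf⟩ := exists_map_finite_of_isCoprime 𝔪
  have : Finite (𝓞 K ⧸ 𝔪) := Ideal.finiteQuotientOfFreeOfNeBot 𝔪 h𝔪
  obtain ⟨i, j, hij, hfij⟩ := Finite.exists_ne_map_eq_of_infinite fun i : ℕ =>
    f ⟨A ^ i, pow_ne_zero i hA, hcA.pow_left⟩
  wlog hlt : j < i generalizing i j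
  · exact this j i hij.symm hfij.symm (lt_of_le_of_ne (not_lt.mp hlt) hij)
  obtain ⟨a, b, ha, hb, hcb, hab, h⟩ := hf _ _ hfij
  dsimp only at h
  obtain ⟨n, rfl⟩ := Nat.exists_eq_add_of_lt hlt
  refine ⟨n + 1, a, b, n.succ_ne_zero, ha, hb, ?_, ?_⟩
  · have h1 : Ideal.absNorm A ^ j ≠ 0 :=
      pow_ne_zero _ fun h0 => hA (Ideal.absNorm_eq_zero_iff.mp h0)
    have h2 := congrArg Ideal.absNorm h
    rw [map_mul, map_mul, map_pow, map_pow] at h2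
    apply mul_right_cancel₀ h1
    rw [← h2]
    ring
  · have h1 := pow_ne_zero j (ϱ.onIdeal_ne_zero hA hcA)
    have h2 := ϱ.onIdeal_mul_pow_eq (pow_ne_zero _ hA) (pow_ne_zero j hA) hcA.pow_left hcA.pow_left
      ha hb hcb hab h
    rw [onIdeal_pow, onIdeal_pow] at h2
    apply mul_right_cancel₀ h1
    rw [← h2]
    ring

theorem isIntegral_onIdeal (h𝔪 : 𝔪 ≠ ⊥) (A : Ideal (𝓞 K)) : IsIntegral ℚ (ϱ.onIdeal A) := by
  by_cases hA : A = 0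
  · rw [hA, onIdeal_zero]; exact isIntegral_zero
  by_cases hcA : IsCoprime A 𝔪
  · obtain ⟨n, a, b, hn, ha, hb, -, h⟩ := ϱ.exists_onIdeal_pow_mul_eq h𝔪 hA hcA
    have hint : ∀ x : K, IsIntegral ℚ (ι x) := fun x =>
      (Algebra.IsIntegral.isIntegral (R := ℚ) x).map (RingHom.toRatAlgHom ι)
    have hb' : ι b ^ (k - 1) ≠ 0 :=
      pow_ne_zero _ ((map_ne_zero ι).mpr (RingOfIntegers.coe_ne_zero_iff.mpr hb))
    refine IsIntegral.of_pow (Nat.pos_of_ne_zero hn) ?_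
    rw [eq_div_of_mul_eq hb' h, ← div_pow, ← map_div₀]
    exact (hint _).pow _
  · rw [ϱ.onIdeal_of_not_isCoprime hcA]; exact isIntegral_zero

/-- The compositum with `ι K` is needed because values are related only up to factors in `ι K`. One
representative per fibre of `f` then suffices. -/
theorem finiteDimensional_fieldRange_sup_valueField (h𝔪 : 𝔪 ≠ ⊥) :
    FiniteDimensional ℚ ((RingHom.toRatAlgHom ι).fieldRange ⊔ ϱ.valueField :
      IntermediateField ℚ ℂ) := by
  classical
  obtain ⟨f, hf⟩ := exists_map_finite_of_isCoprime 𝔪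
  have : Finite (𝓞 K ⧸ 𝔪) := Ideal.finiteQuotientOfFreeOfNeBot 𝔪 h𝔪
  obtain ⟨s, hs⟩ : ∃ s : ClassGroup (𝓞 K) × (𝓞 K ⧸ 𝔪) → Ideal (𝓞 K),
      ∀ A : {A : Ideal (𝓞 K) // A ≠ 0 ∧ IsCoprime A 𝔪}, ∃ c : K, ϱ.onIdeal A = ι c * ϱ.onIdeal (s (f A)) := by
    refine ⟨fun x => if h : ∃ A, f A = x then (h.choose : Ideal (𝓞 K)) else 0, fun A => ?_⟩
    have hex : ∃ B, f B = f A := ⟨A, rfl⟩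
    obtain ⟨a, b, ha, hb, hcb, hab, h⟩ := hf A hex.choose hex.choose_spec.symm
    refine ⟨((a : K) / b) ^ (k - 1), ?_⟩
    beta_reduce
    rw [dif_pos hex]
    have h1 := ϱ.onIdeal_mul_pow_eq A.2.1 hex.choose.2.1 A.2.2 hex.choose.2.2 ha hb hcb hab h
    have hb' : ι b ^ (k - 1) ≠ 0 :=
      pow_ne_zero _ ((map_ne_zero ι).mpr (RingOfIntegers.coe_ne_zero_iff.mpr hb))
    rw [eq_div_of_mul_eq hb' h1, map_pow, map_div₀, div_pow]
    ring
  let T : IntermediateField ℚ ℂ := (RingHom.toRatAlgHom ι).fieldRange ⊔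
    IntermediateField.adjoin ℚ (Set.range fun x => ϱ.onIdeal (s x))
  have h1 : FiniteDimensional ℚ (RingHom.toRatAlgHom ι).fieldRange :=
    LinearMap.finiteDimensional_range (RingHom.toRatAlgHom ι).toLinearMap
  have h2 : FiniteDimensional ℚ
      (IntermediateField.adjoin ℚ (Set.range fun x => ϱ.onIdeal (s x))) := by
    have := (Set.finite_range fun x => ϱ.onIdeal (s x)).to_subtype
    refine IntermediateField.finiteDimensional_adjoin ?_
    rintro _ ⟨x, rfl⟩
    exact ϱ.isIntegral_onIdeal h𝔪 _
  have hT : FiniteDimensional ℚ T := IntermediateField.finiteDimensional_sup _ _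
  have hle : (RingHom.toRatAlgHom ι).fieldRange ⊔ ϱ.valueField ≤ T := by
    refine sup_le le_sup_left (ϱ.valueField_le_of_prime T fun P hP => ?_)
    by_cases hc : IsCoprime P 𝔪
    · obtain ⟨c, hc⟩ := hs ⟨P, hP.ne_zero, hc⟩
      rw [hc]
      refine mul_mem ((le_sup_left : _ ≤ T) ⟨c, rfl⟩) ((le_sup_right : _ ≤ T) ?_)
      exact IntermediateField.subset_adjoin ℚ _ ⟨_, rfl⟩
    · rw [ϱ.onIdeal_of_not_isCoprime hc]
      exact zero_mem _
  exact FiniteDimensional.of_injective (IntermediateField.inclusion hle).toLinearMap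
    (IntermediateField.inclusion_injective hle)

end AlgebraicHeckeCharacter

end CMTheta

/-! ### Complex conjugation and the Kroneckerian property -/

namespace CMTheta

open scoped ComplexConjugate

theorem isKroneckerian_of_forall_conj {L : Type*} [Field L] [NumberField L] (τ : L →+* L)
    (h : ∀ (φ : L →+* ℂ) (x : L), φ (τ x) = conj (φ x)) : IsKroneckerian L := by
  refine ⟨inferInstance, ?_⟩
  have φ₀ : L →+* ℂ := Classical.choice inferInstance
  by_cases hτ : ∀ x, τ x = x
  · refine Or.inl ⟨fun v => ?_⟩
    rw [InfinitePlace.isReal_iff, ComplexEmbedding.isReal_iff]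
    ext x
    rw [ComplexEmbedding.conjugate_coe_eq, ← h, hτ]
  right
  have hττ : ∀ x, τ (τ x) = x := fun x => φ₀.injective (by rw [h, h, Complex.conj_conj])
  have hreal : ∀ (φ : L →+* ℂ) (x : L), conj (φ x) = φ x ↔ τ x = x := fun φ x => by
    rw [← h, φ.injective.eq_iff]
  have hc : IsTotallyComplex L := ⟨fun v => by
    rw [← InfinitePlace.not_isReal_iff_isComplex, InfinitePlace.isReal_iff,
      ComplexEmbedding.isReal_iff]
    refine fun hv => hτ fun x => (hreal v.embedding x).mp ?_
    rw [← ComplexEmbedding.conjugate_coe_eq, hv]⟩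
  have hmem : ∀ x : L, x ∈ maximalRealSubfield L ↔ τ x = x := fun x =>
    ⟨fun hx => (hreal φ₀ x).mp (hx φ₀), fun hx φ => (hreal φ x).mpr hx⟩
  push Not at hτ
  obtain ⟨y, hy⟩ := hτ
  set d := y - τ y with hd
  have hd0 : d ≠ 0 := sub_ne_zero.mpr (Ne.symm hy)
  have hτd : τ d = -d := by rw [hd, map_sub, hττ, neg_sub]
  -- The maximal real subfield is the fixed field of `τ`. Splitting into `τ`-even and `τ`-odd parts
  -- shows that 1 and `d` form a basis over it.
  refine @IsCMField.mk L _ _ hc ⟨?_⟩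
  have hli : LinearIndependent (maximalRealSubfield L) ![(1 : L), d] := by
    rw [LinearIndependent.pair_iff]
    intro s t hst
    have hs := (hmem s).mp s.2
    have ht := (hmem t).mp t.2
    simp only [Subfield.smul_def, smul_eq_mul, mul_one] at hst
    have h2 := congrArg τ hst
    rw [map_add, map_mul, hs, ht, hτd, map_zero] at h2
    have h3 : (2 : L) * s = 0 := by linear_combination hst + h2
    have h4 : (s : L) = 0 := (mul_eq_zero.mp h3).resolve_left two_ne_zero
    rw [h4, zero_add] at hst
    exact ⟨Subtype.ext h4, Subtype.ext ((mul_eq_zero.mp hst).resolve_right hd0)⟩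
  have hsp : ⊤ ≤ Submodule.span (maximalRealSubfield L) (Set.range ![(1 : L), d]) := by
    intro x _
    have h1 : (x + τ x) / 2 ∈ maximalRealSubfield L := by
      rw [hmem, map_div₀, map_add, hττ, map_ofNat, add_comm]
    have h2 : (x - τ x) / (2 * d) ∈ maximalRealSubfield L := by
      rw [hmem, map_div₀, map_sub, hττ, map_mul, map_ofNat, hτd, mul_neg, div_neg, ← neg_div,
        neg_sub]
    have h3 : x = (⟨_, h1⟩ : maximalRealSubfield L) • (1 : L) +
        (⟨_, h2⟩ : maximalRealSubfield L) • d := by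
      simp only [Subfield.smul_def, smul_eq_mul]
      field_simp
      ring
    rw [h3]
    exact add_mem (Submodule.smul_mem _ _ (Submodule.subset_span ⟨0, rfl⟩))
      (Submodule.smul_mem _ _ (Submodule.subset_span ⟨1, rfl⟩))
  rw [Module.finrank_eq_card_basis (Module.Basis.mk hli hsp), Fintype.card_fin]

variable {K : Type*} [Field K] [NumberField K] {ι : K →+* ℂ} {𝔪 : Ideal (𝓞 K)} {k : ℕ}

/-- There is a single infinite place, of multiplicity 2, so the product of absolute values giving
the norm has one factor. -/
theorem norm_sq_embedding_eq_absNorm (hquad : Module.finrank ℚ K = 2) (him : IsTotallyComplex K)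
    (φ : K →+* ℂ) (a : 𝓞 K) : ‖φ a‖ ^ 2 = Ideal.absNorm (Ideal.span {a}) := by
  have h1 : Fintype.card (InfinitePlace K) = 1 := by
    have h2 := IsTotallyComplex.finrank K
    rw [hquad] at h2
    rw [InfinitePlace.card_eq_nrRealPlaces_add_nrComplexPlaces,
      IsTotallyComplex.nrRealPlaces_eq_zero]
    omega
  obtain ⟨w, hw⟩ := Fintype.card_eq_one_iff.mp h1
  have h3 := InfinitePlace.prod_eq_abs_norm (a : K)
  have h4 : (Finset.univ : Finset (InfinitePlace K)) = {InfinitePlace.mk φ} := by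
    ext v
    simp [hw v, hw (InfinitePlace.mk φ)]
  rw [h4, Finset.prod_singleton, IsTotallyComplex.mult_eq, InfinitePlace.apply] at h3
  rw [h3, Ideal.absNorm_span_singleton, ← Algebra.coe_norm_int, Nat.cast_natAbs]
  norm_cast

namespace AlgebraicHeckeCharacter

variable (ϱ : AlgebraicHeckeCharacter ι 𝔪 k)

theorem numberField_valueField (h𝔪 : 𝔪 ≠ ⊥) : NumberField ϱ.valueField := by
  have := ϱ.finiteDimensional_fieldRange_sup_valueField h𝔪
  have hle : ϱ.valueField ≤ (RingHom.toRatAlgHom ι).fieldRange ⊔ ϱ.valueField := le_sup_right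
  have : FiniteDimensional ℚ ϱ.valueField :=
    FiniteDimensional.of_injective (IntermediateField.inclusion hle).toLinearMap
      (IntermediateField.inclusion_injective hle)
  exact ⟨⟩

theorem norm_sq_map_onIdeal (hquad : Module.finrank ℚ K = 2) (him : IsTotallyComplex K)
    (h𝔪 : 𝔪 ≠ ⊥) (φ : ϱ.valueField →+* ℂ) {A : Ideal (𝓞 K)} (hA : A ≠ 0)
    (hcA : IsCoprime A 𝔪) :
    ‖φ ⟨ϱ.onIdeal A, ϱ.onIdeal_mem_valueField A⟩‖ ^ 2 = (Ideal.absNorm A : ℝ) ^ (k - 1) := by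
  let E : IntermediateField ℚ ℂ := (RingHom.toRatAlgHom ι).fieldRange ⊔ ϱ.valueField
  have hE : FiniteDimensional ℚ E := ϱ.finiteDimensional_fieldRange_sup_valueField h𝔪
  let j : ϱ.valueField →+* E := (IntermediateField.inclusion le_sup_right).toRingHom
  let _ : Algebra ϱ.valueField E := j.toAlgebra
  have : Algebra.IsAlgebraic ϱ.valueField E := Algebra.IsAlgebraic.tower_top (K := ℚ) _
  -- `a` and `b` need not map into ℚ(ϱ), so `φ` is extended to the compositum with `ι K`.
  let ψ : E →+* ℂ := ComplexEmbedding.lift E φ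
  let κ : K →+* E := ι.codRestrict E.toSubfield fun x =>
    (le_sup_left : (RingHom.toRatAlgHom ι).fieldRange ≤ E) ⟨x, rfl⟩
  obtain ⟨n, a, b, hn, ha, hb, hN, h⟩ := ϱ.exists_onIdeal_pow_mul_eq h𝔪 hA hcA
  set x : ϱ.valueField := ⟨ϱ.onIdeal A, ϱ.onIdeal_mem_valueField A⟩ with hx
  have h1 : j x ^ n * κ b ^ (k - 1) = κ a ^ (k - 1) := Subtype.ext h
  have h2 := congrArg (fun z => ‖ψ z‖ ^ 2) h1
  have h3 : ψ (j x) = φ x := ComplexEmbedding.lift_algebraMap_apply E φ x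
  have h4 : ∀ c : 𝓞 K, ‖ψ (κ c)‖ ^ 2 = Ideal.absNorm (Ideal.span {c}) :=
    norm_sq_embedding_eq_absNorm hquad him (ψ.comp κ)
  simp only [map_mul, map_pow, norm_mul, norm_pow, h3, mul_pow] at h2
  rw [pow_right_comm _ (k - 1) 2, pow_right_comm _ (k - 1) 2, pow_right_comm _ n 2, h4, h4, ← hN,
    Nat.cast_mul, mul_pow, Nat.cast_pow, pow_right_comm _ n (k - 1)] at h2
  have h5 : (Ideal.absNorm (Ideal.span {b}) : ℝ) ^ (k - 1) ≠ 0 := by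
    refine pow_ne_zero _ (Nat.cast_ne_zero.mpr fun h0 => hb ?_)
    exact Ideal.span_singleton_eq_bot.mp (Ideal.absNorm_eq_zero_iff.mp h0)
  exact (pow_left_inj₀ (by positivity) (by positivity) hn).mp (mul_right_cancel₀ h5 h2)

theorem conj_map_onIdeal (hquad : Module.finrank ℚ K = 2) (him : IsTotallyComplex K)
    (h𝔪 : 𝔪 ≠ ⊥) (φ : ϱ.valueField →+* ℂ) {A : Ideal (𝓞 K)} (hA : A ≠ 0)
    (hcA : IsCoprime A 𝔪) :
    conj (φ ⟨ϱ.onIdeal A, ϱ.onIdeal_mem_valueField A⟩) =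
      φ ((Ideal.absNorm A : ϱ.valueField) ^ (k - 1) /
        ⟨ϱ.onIdeal A, ϱ.onIdeal_mem_valueField A⟩) := by
  have h := ϱ.norm_sq_map_onIdeal hquad him h𝔪 φ hA hcA
  have h0 : φ ⟨ϱ.onIdeal A, ϱ.onIdeal_mem_valueField A⟩ ≠ 0 :=
    (map_ne_zero φ).mpr fun h0 => ϱ.onIdeal_ne_zero hA hcA (congrArg Subtype.val h0)
  rw [map_div₀, map_pow, map_natCast, eq_div_iff h0, Complex.conj_mul']
  exact_mod_cast h

theorem isKroneckerian_valueField (hquad : Module.finrank ℚ K = 2) (him : IsTotallyComplex K)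
    (h𝔪 : 𝔪 ≠ ⊥) : IsKroneckerian ϱ.valueField := by
  have := ϱ.numberField_valueField h𝔪
  have hval : ∀ A, conj (ϱ.onIdeal A) ∈ ϱ.valueField := fun A => by
    by_cases hA : A = 0
    · rw [hA, onIdeal_zero, map_zero]; exact zero_mem _
    by_cases hcA : IsCoprime A 𝔪
    · have h : conj (ϱ.onIdeal A) = (((Ideal.absNorm A : ϱ.valueField) ^ (k - 1) /
          ⟨ϱ.onIdeal A, ϱ.onIdeal_mem_valueField A⟩ : ϱ.valueField) : ℂ) :=
        ϱ.conj_map_onIdeal hquad him h𝔪 ϱ.valueField.val.toRingHom hA hcA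
      rw [h]
      exact SetLike.coe_mem _
    · rw [ϱ.onIdeal_of_not_isCoprime hcA, map_zero]; exact zero_mem _
  have hle : ϱ.valueField ≤ ϱ.valueField.comap (RingHom.toRatAlgHom (starRingEnd ℂ)) :=
    ϱ.valueField_le_of_prime _ fun P _ => hval P
  let τ : ϱ.valueField →+* ϱ.valueField :=
    ((starRingEnd ℂ).comp ϱ.valueField.val.toRingHom).codRestrict ϱ.valueField.toSubfield
      fun x => hle x.2
  refine isKroneckerian_of_forall_conj τ fun φ x => ?_
  -- Both maps send a nonzero generator ϱ(A) to φ(N(A)^(k-1)/ϱ(A)).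
  have hext : RingHom.toRatAlgHom (φ.comp τ) = RingHom.toRatAlgHom ((starRingEnd ℂ).comp φ) := by
    refine IntermediateField.algHom_ext_of_eq_adjoin _ ϱ.valueField_eq_adjoin_onIdeal ?_
    rintro _ ⟨A, rfl⟩
    change φ (τ ⟨ϱ.onIdeal A, _⟩) = conj (φ ⟨ϱ.onIdeal A, _⟩)
    by_cases h0 : ϱ.onIdeal A = 0
    · have h1 : (⟨ϱ.onIdeal A, ϱ.onIdeal_mem_valueField A⟩ : ϱ.valueField) = 0 := Subtype.ext h0
      rw [h1, map_zero, map_zero, map_zero]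
    have hA : A ≠ 0 := by rintro rfl; exact h0 ϱ.onIdeal_zero
    have hcA : IsCoprime A 𝔪 := by
      by_contra hcA
      exact h0 (ϱ.onIdeal_of_not_isCoprime hcA)
    rw [ϱ.conj_map_onIdeal hquad him h𝔪 φ hA hcA]
    congr 1
    exact Subtype.ext (ϱ.conj_map_onIdeal hquad him h𝔪 ϱ.valueField.val.toRingHom hA hcA)
  exact DFunLike.congr_fun hext x

end AlgebraicHeckeCharacter

end CMTheta

/-! ### Extensions generated by split quadratics -/

namespace CMTheta

open Polynomial in
theorem isGalois_of_adjoin_eq_of_quadratic {F L : Type*} [Field F] [CharZero F] [Field L]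
    [Algebra F L] {E : IntermediateField F L} {S : Set L}
    (hE : E = IntermediateField.adjoin F S)
    (hS : ∀ x ∈ S, ∃ y ∈ E, ∃ s t : F, x + y = algebraMap F L s ∧ x * y = algebraMap F L t) :
    IsGalois F E ∧ IsElementaryAbelianTwoGroup (E ≃ₐ[F] E) := by
  have hSE : ∀ x ∈ S, x ∈ E := fun x hx => hE ▸ IntermediateField.subset_adjoin F S hx
  have key : ∀ x ∈ S, IsIntegral F x ∧ ((minpoly F x).map (algebraMap F E)).Splits := by
    intro x hx
    obtain ⟨y, hy, s, t, hs, ht⟩ := hS x hx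
    have hmonic : (X ^ 2 - C s * X + C t : F[X]).Monic := by monicity!
    have hroot : aeval x (X ^ 2 - C s * X + C t : F[X]) = 0 := by
      simp only [map_add, map_sub, map_mul, map_pow, aeval_X, aeval_C]
      rw [← hs, ← ht]
      ring
    refine ⟨⟨_, hmonic, hroot⟩, ?_⟩
    have hfac : (X ^ 2 - C s * X + C t : F[X]).map (algebraMap F E) =
        (X - C ⟨x, hSE x hx⟩) * (X - C ⟨y, hy⟩) := by
      have hs' : algebraMap F E s = ⟨x, hSE x hx⟩ + ⟨y, hy⟩ := Subtype.ext hs.symm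
      have ht' : algebraMap F E t = ⟨x, hSE x hx⟩ * ⟨y, hy⟩ := Subtype.ext ht.symm
      simp only [Polynomial.map_add, Polynomial.map_sub, Polynomial.map_mul, Polynomial.map_pow,
        map_X, map_C, hs', ht', C_add, C_mul]
      ring
    refine Splits.of_dvd (g := (X ^ 2 - C s * X + C t : F[X]).map (algebraMap F E)) ?_
      (hmonic.map _).ne_zero (Polynomial.map_dvd _ (minpoly.dvd F x hroot))
    rw [hfac]
    exact (Splits.X_sub_C _).mul (Splits.X_sub_C _)
  have hint : ∀ x : E, IsIntegral F x := by
    intro x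
    have : Algebra.IsAlgebraic F (IntermediateField.adjoin F S) :=
      IntermediateField.isAlgebraic_adjoin fun x hx => (key x hx).1
    rw [← hE] at this
    exact Algebra.IsIntegral.isIntegral x
  have hnormal : Normal F E := normal_iff.mpr fun x => ⟨hint x, by
    rw [IntermediateField.minpoly_eq]
    exact IntermediateField.splits_of_mem_adjoin F L key (hE ▸ x.2)⟩
  have hsq : ∀ (g : E ≃ₐ[F] E) (x : E), g (g x) = x := by
    intro g x
    have : ((g.trans g : E ≃ₐ[F] E) : E →ₐ[F] E) = AlgHom.id F E := by
      refine IntermediateField.algHom_ext_of_eq_adjoin F hE fun x hx => ?_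
      obtain ⟨y, hy, s, t, hs, ht⟩ := hS x hx
      change g (g ⟨x, hSE x hx⟩) = ⟨x, hSE x hx⟩
      set x' : E := ⟨x, hSE x hx⟩
      have hs' : x' + ⟨y, hy⟩ = algebraMap F E s := Subtype.ext hs
      have ht' : x' * ⟨y, hy⟩ = algebraMap F E t := Subtype.ext ht
      have h1 : g x' + g ⟨y, hy⟩ = x' + ⟨y, hy⟩ := by rw [← map_add, hs', g.commutes]
      have h2 : g x' * g ⟨y, hy⟩ = x' * ⟨y, hy⟩ := by rw [← map_mul, ht', g.commutes]
      -- `g` preserves the sum and product of the two roots, so it sends `x'` to one of them.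
      have h3 : (g x' - x') * (g x' - ⟨y, hy⟩) = 0 := by linear_combination g x' * h1 - h2
      rcases mul_eq_zero.mp h3 with h | h
      · rw [sub_eq_zero.mp h, sub_eq_zero.mp h]
      · have h4 : g x' = ⟨y, hy⟩ := sub_eq_zero.mp h
        rw [h4] at h1 ⊢
        linear_combination h1
    exact DFunLike.congr_fun this x
  have hpow : ∀ g : E ≃ₐ[F] E, g ^ 2 = 1 := fun g => by
    ext1 x
    rw [pow_two]
    exact hsq g x
  refine ⟨⟨⟩, fun g h => ?_, hpow⟩
  have hinv : ∀ g : E ≃ₐ[F] E, g⁻¹ = g := fun g =>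
    inv_eq_of_mul_eq_one_left (by rw [← pow_two, hpow])
  rw [← hinv (g * h), mul_inv_rev, hinv, hinv]

/-! ### Ideals of norm p and p², and the theta coefficients -/

variable {K : Type*} [Field K] [NumberField K] {ι : K →+* ℂ} {𝔪 : Ideal (𝓞 K)} {k : ℕ}

theorem exists_prime_absNorm_of_finrank_eq_two (hquad : Module.finrank ℚ K = 2)
    {P : Ideal (𝓞 K)} (hP : Prime P) :
    ∃ p : ℕ, p.Prime ∧ ∃ Q : Ideal (𝓞 K), P * Q = Ideal.span {(p : 𝓞 K)} ∧
      (Ideal.absNorm P = p ∧ Ideal.absNorm Q = p ∨ Ideal.absNorm P = p ^ 2) := by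
  have hmax : P.IsMaximal := (Ideal.isPrime_of_prime hP).isMaximal hP.ne_zero
  obtain ⟨p, n, hn, hmem, hp, hN⟩ := Ideal.exists_prime_and_absNorm_eq_pow P
  obtain ⟨Q, hQ⟩ := Ideal.dvd_span_singleton.mpr hmem
  refine ⟨p, hp, Q, hQ.symm, ?_⟩
  have h1 : Ideal.absNorm P * Ideal.absNorm Q = p ^ 2 := by
    rw [← map_mul, ← hQ, Ideal.absNorm_span_natCast, RingOfIntegers.rank, hquad]
  have hn2 : n ≤ 2 := (Nat.pow_dvd_pow_iff_le_right hp.one_lt).mp (hN ▸ Dvd.intro _ h1)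
  interval_cases n
  · rw [pow_one] at hN
    rw [hN, pow_two] at h1
    exact Or.inl ⟨hN, mul_left_cancel₀ hp.ne_zero h1⟩
  · exact Or.inr hN

theorem eq_of_absNorm_eq_prime {P I : Ideal (𝓞 K)} {p : ℕ} (hp : p.Prime)
    (hP : Ideal.absNorm P = p) (hI : Ideal.absNorm I = p) (h : I ∣ P) : I = P := by
  have hprime : ∀ J : Ideal (𝓞 K), Ideal.absNorm J = p → Irreducible J := fun J hJ =>
    Ideal.irreducible_of_irreducible_absNorm (hJ ▸ (Nat.irreducible_iff_nat_prime p).mpr hp)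
  exact associated_iff_eq.mp ((hprime I hI).associated_of_dvd (hprime P hP) h)

theorem absNorm_eq_prime_iff {P Q : Ideal (𝓞 K)} {p : ℕ} (hp : p.Prime)
    (hPQ : P * Q = Ideal.span {(p : 𝓞 K)}) (hP : Ideal.absNorm P = p)
    (hQ : Ideal.absNorm Q = p) (I : Ideal (𝓞 K)) :
    Ideal.absNorm I = p ↔ I = P ∨ I = Q := by
  refine ⟨fun hI => ?_, by rintro (rfl | rfl) <;> assumption⟩
  have hIprime : Prime I := UniqueFactorizationMonoid.irreducible_iff_prime.mp
    (Ideal.irreducible_of_irreducible_absNorm (hI ▸ (Nat.irreducible_iff_nat_prime p).mpr hp))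
  have hdvd : I ∣ P * Q := by
    rw [hPQ, Ideal.dvd_span_singleton, ← hI]
    exact Ideal.absNorm_mem I
  exact (hIprime.dvd_or_dvd hdvd).imp (eq_of_absNorm_eq_prime hp hP hI)
    (eq_of_absNorm_eq_prime hp hQ hI)

/-- A maximal ideal containing `I` divides (p), so it has norm `p`, and so does its cofactor in `I`.
Both are then `P` or `Q`. -/
theorem absNorm_eq_prime_sq_iff {P Q : Ideal (𝓞 K)} {p : ℕ} (hp : p.Prime)
    (hPQ : P * Q = Ideal.span {(p : 𝓞 K)}) (hP : Ideal.absNorm P = p)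
    (hQ : Ideal.absNorm Q = p) (I : Ideal (𝓞 K)) :
    Ideal.absNorm I = p ^ 2 ↔ I = P * P ∨ I = P * Q ∨ I = Q * Q := by
  constructor
  · intro hI
    have hI1 : I ≠ ⊤ := by
      rintro rfl
      rw [Ideal.absNorm_top] at hI
      exact (Nat.one_lt_pow two_ne_zero hp.one_lt).ne hI
    obtain ⟨M, hM, hIM⟩ := Ideal.exists_le_maximal I hI1
    have hpM : (p : 𝓞 K) ∈ M := by
      refine hM.isPrime.mem_of_pow_mem 2 (hIM ?_)
      rw [← Nat.cast_pow, ← hI]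
      exact Ideal.absNorm_mem I
    have hM0 : M ≠ ⊥ := by
      rintro rfl
      exact hp.ne_zero (by exact_mod_cast (Ideal.mem_bot.mp hpM : (p : 𝓞 K) = 0))
    have hMprime : Prime M := Ideal.prime_of_isPrime hM0 hM.isPrime
    have hMN : Ideal.absNorm M = p := by
      have hdvd : M ∣ P * Q := by rwa [hPQ, Ideal.dvd_span_singleton]
      have hM1 : Ideal.absNorm M ≠ 1 := fun h => hM.ne_top (Ideal.absNorm_eq_one_iff.mp h)
      rcases hMprime.dvd_or_dvd hdvd with h | h
      · exact (hp.eq_one_or_self_of_dvd _ (hP ▸ map_dvd Ideal.absNorm h)).resolve_left hM1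
      · exact (hp.eq_one_or_self_of_dvd _ (hQ ▸ map_dvd Ideal.absNorm h)).resolve_left hM1
    obtain ⟨J, rfl⟩ := Ideal.dvd_iff_le.mpr hIM
    have hJN : Ideal.absNorm J = p := by
      rw [map_mul, hMN, pow_two] at hI
      exact mul_left_cancel₀ hp.ne_zero hI
    rw [absNorm_eq_prime_iff hp hPQ hP hQ] at hMN hJN
    rcases hMN with rfl | rfl <;> rcases hJN with rfl | rfl
    · exact Or.inl rfl
    · exact Or.inr (Or.inl rfl)
    · exact Or.inr (Or.inl (mul_comm _ _))
    · exact Or.inr (Or.inr rfl)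
  · rintro (rfl | rfl | rfl) <;> simp only [map_mul, hP, hQ, pow_two]

/-- An ideal contains its norm, so `I` divides (p²) = P² and is a power of `P`; the norm forces
exponent 1. -/
theorem absNorm_eq_prime_sq_iff_of_prime {P : Ideal (𝓞 K)} (hP : Prime P) {p : ℕ}
    (hp : p.Prime) (hPN : Ideal.absNorm P = p ^ 2) (hpP : Ideal.span {(p : 𝓞 K)} = P)
    (I : Ideal (𝓞 K)) : Ideal.absNorm I = p ^ 2 ↔ I = P := by
  refine ⟨fun hI => ?_, by rintro rfl; exact hPN⟩
  have hdvd : I ∣ P ^ 2 := by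
    rw [← hpP, Ideal.span_singleton_pow, Ideal.dvd_span_singleton, ← Nat.cast_pow, ← hI]
    exact Ideal.absNorm_mem I
  obtain ⟨j, -, hj⟩ := (dvd_prime_pow hP 2).mp hdvd
  rw [associated_iff_eq] at hj
  rw [hj, map_pow, hPN, ← pow_mul] at hI
  have h2 := Nat.pow_right_injective hp.two_le hI
  rw [hj, show j = 1 by omega, pow_one]

namespace AlgebraicHeckeCharacter

variable (ϱ : AlgebraicHeckeCharacter ι 𝔪 k)

theorem sum_onIdeal_mem_coeffField {n : ℕ} (s : Finset (Ideal (𝓞 K)))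
    (hs : ∀ I, Ideal.absNorm I = n ↔ I ∈ s) : ∑ I ∈ s, ϱ.onIdeal I ∈ ϱ.coeffField := by
  refine IntermediateField.subset_adjoin ℚ _ ⟨n, ?_⟩
  simp only [theta, PowerSeries.coeff_mk]
  refine Finset.sum_congr ?_ fun _ _ => rfl
  ext I
  rw [Set.Finite.mem_toFinset, ← hs]
  rfl

theorem exists_add_mem_mul_mem_coeffField (hquad : Module.finrank ℚ K = 2) {P : Ideal (𝓞 K)}
    (hP : Prime P) : ∃ y ∈ ϱ.valueField,
      ϱ.onIdeal P + y ∈ ϱ.coeffField ∧ ϱ.onIdeal P * y ∈ ϱ.coeffField := by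
  classical
  have hself : ϱ.onIdeal P ∈ ϱ.coeffField → ∃ y ∈ ϱ.valueField,
      ϱ.onIdeal P + y ∈ ϱ.coeffField ∧ ϱ.onIdeal P * y ∈ ϱ.coeffField := fun h =>
    -- When the value already lies in F, the second root 0 gives a degenerate quadratic.
    ⟨0, zero_mem _, by rwa [add_zero], by rw [mul_zero]; exact zero_mem _⟩
  obtain ⟨p, hp, Q, hPQ, ⟨hPN, hQN⟩ | hPN⟩ := exists_prime_absNorm_of_finrank_eq_two hquad hP
  · have h1 := absNorm_eq_prime_iff hp hPQ hPN hQN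
    have h2 := absNorm_eq_prime_sq_iff hp hPQ hPN hQN
    by_cases hne : P = Q
    -- Ramified case: `P` is the only ideal of norm `p`.
    · refine hself ?_
      have := ϱ.sum_onIdeal_mem_coeffField {P} fun I => by rw [h1 I, ← hne]; simp
      rwa [Finset.sum_singleton] at this
    have hP0 : P ≠ 0 := hP.ne_zero
    have hQ0 : Q ≠ 0 := by
      rintro rfl
      exact hp.ne_zero (by rw [← hQN]; exact Ideal.absNorm_bot)
    have hPPQ : P * P ≠ P * Q := fun h => hne (mul_left_cancel₀ hP0 h)
    have hPQQ : P * Q ≠ Q * Q := fun h => hne (mul_right_cancel₀ hQ0 h)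
    have hPPQQ : P * P ≠ Q * Q := by
      intro h
      have hd : P ∣ Q := hP.dvd_of_dvd_pow (n := 2) (by rw [pow_two, ← h]; exact dvd_mul_right _ _)
      exact hne (eq_of_absNorm_eq_prime hp hQN hPN hd)
    have hsum := ϱ.sum_onIdeal_mem_coeffField {P, Q} fun I => by rw [h1 I]; simp
    have hsum2 := ϱ.sum_onIdeal_mem_coeffField {P * P, P * Q, Q * Q} fun I => by rw [h2 I]; simp
    rw [Finset.sum_pair hne] at hsum
    rw [Finset.sum_insert (by simp [hPPQ, hPPQQ]), Finset.sum_pair hPQQ, onIdeal_mul, onIdeal_mul,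
      onIdeal_mul] at hsum2
    refine ⟨ϱ.onIdeal Q, ϱ.onIdeal_mem_valueField Q, hsum, ?_⟩
    -- (x + y)² - (x² + xy + y²) = xy.
    have := sub_mem (pow_mem hsum 2) hsum2
    convert! this using 1
    ring
  -- Inert case: `P = (p)` is the only ideal of norm p².
  · refine hself ?_
    have hQ : Q = ⊤ := by
      have h3 := congrArg Ideal.absNorm hPQ
      rw [map_mul, Ideal.absNorm_span_natCast, RingOfIntegers.rank, hquad, hPN] at h3
      exact Ideal.absNorm_eq_one_iff.mp
        (mul_left_cancel₀ (pow_ne_zero 2 hp.ne_zero) (h3.trans (mul_one _).symm))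
    rw [hQ, ← Ideal.one_eq_top, mul_one] at hPQ
    have h1 := absNorm_eq_prime_sq_iff_of_prime hP hp hPN hPQ.symm
    have := ϱ.sum_onIdeal_mem_coeffField {P} fun I => by rw [h1 I]; simp
    rwa [Finset.sum_singleton] at this

theorem valueFieldOver_eq_adjoin :
    ϱ.valueFieldOver = IntermediateField.adjoin ϱ.coeffField (ϱ.onIdeal '' {P | Prime P}) := by
  apply le_antisymm
  · intro x hx
    rw [IntermediateField.mem_extendScalars] at hx
    rw [← IntermediateField.mem_restrictScalars (K := ℚ)]
    refine ϱ.valueField_le_of_prime _ (fun P hP => ?_) hx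
    rw [IntermediateField.mem_restrictScalars]
    exact IntermediateField.subset_adjoin ϱ.coeffField _ (Set.mem_image_of_mem ϱ.onIdeal hP)
  · rw [IntermediateField.adjoin_le_iff]
    rintro _ ⟨P, -, rfl⟩
    exact ϱ.onIdeal_mem_valueField P

end AlgebraicHeckeCharacter

end CMTheta

theorem mainTheorem9 {K : Type*} [Field K] [NumberField K]
    (hquad : Module.finrank ℚ K = 2) (him : NumberField.IsTotallyComplex K) (ι : K →+* ℂ)
    (𝔪 : Ideal (NumberField.RingOfIntegers K)) (h𝔪 : 𝔪 ≠ ⊥) (k : ℕ) (hk : 1 ≤ k)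
    (ϱ : CMTheta.AlgebraicHeckeCharacter ι 𝔪 k) :
    (IsGalois ϱ.coeffField ϱ.valueFieldOver ∧
      FiniteDimensional ϱ.coeffField ϱ.valueFieldOver ∧
      CMTheta.IsElementaryAbelianTwoGroup (ϱ.valueFieldOver ≃ₐ[ϱ.coeffField] ϱ.valueFieldOver)) ∧
    CMTheta.IsKroneckerian ϱ.valueField := by
  have hgal := CMTheta.isGalois_of_adjoin_eq_of_quadratic ϱ.valueFieldOver_eq_adjoin (by
    rintro _ ⟨P, hP, rfl⟩
    obtain ⟨y, hy, hs, ht⟩ := ϱ.exists_add_mem_mul_mem_coeffField hquad hP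
    exact ⟨y, hy, ⟨_, hs⟩, ⟨_, ht⟩, rfl, rfl⟩)
  have hnf := ϱ.numberField_valueField h𝔪
  -- `valueFieldOver` has the same elements as `valueField`, so finiteness over ℚ transfers.
  have hfin : FiniteDimensional ℚ ϱ.valueFieldOver := hnf.to_finiteDimensional
  exact ⟨⟨hgal.1, FiniteDimensional.right ℚ ϱ.coeffField ϱ.valueFieldOver, hgal.2⟩,
    ϱ.isKroneckerian_valueField hquad him h𝔪⟩
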